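/- Let $A \in \mathbb{C}^{m \times n}$, let $S_1 \in \mathbb{C}^{m \times m}$ and $S_2 \in \mathbb{C}^{n \times n}$ be skew-Hermitian (that is, $S_1^* = -S_1$ and $S_2^* = -S_2$), and put $E := S_1 A + A S_2$. For a matrix $M \in \mathbb{C}^{m\times n}$ let $\sigma_1(M) \ge \sigma_2(M) \ge \dots \ge \sigma_{\min(m,n)}(M) \ge 0$ be its singular values, and let $\|\cdot\|$ denote the spectral norm. Then, for every $i = 1, \dots, \min(m,n)$, $$ |\sigma_i(A+E) - \sigma_i(A)| \;\le\; \tfrac12 \,\bigl\| S_1^2 A + 2\,S_1 A S_2 + A S_2^2 \bigr\| \;\le\; \tfrac12\, \|E\|\,\bigl(\|S_1\| + \|S_2\|\bigr). $$ -/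

import Mathlib

/- `‖M‖` for a complex matrix is the spectral norm (the operator norm for the Euclidean norms). -/
open scoped Matrix Matrix.Norms.L2Operator

/-! Since `S₁` and `S₂` are skew-Hermitian, `exp (t S₁) * A * exp (t S₂)` moves inside the unitary
equivalence class of `A`, so its singular values are constant. At `t = 0` its value is `A` and its
velocity is `E`, so `A + E` is its first order Taylor polynomial at `t = 1`. The second derivative
is `G = S₁ * E + E * S₂` between two unitaries, so the remainder has norm at most `‖G‖ / 2`. Weyl's
perturbation inequality turns this distance into the bound on singular values; expanding `G` gives
the stated matrix. -/

open Module in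
theorem OrthonormalBasis.exists_submodule_repr_eq_zero {𝕜 V : Type*} [RCLike 𝕜]
    [NormedAddCommGroup V] [InnerProductSpace 𝕜 V] {n : ℕ} (b : OrthonormalBasis (Fin n) 𝕜 V)
    (s : Finset (Fin n)) :
    ∃ U : Submodule 𝕜 V, finrank 𝕜 U = s.card ∧ ∀ x ∈ U, ∀ j ∉ s, b.repr x j = 0 := by
  refine ⟨Submodule.span 𝕜 (b '' s), ?_, fun x hx j hj => ?_⟩
  · rw [Set.image_eq_range]
    have h := b.orthonormal.linearIndependent.comp ((↑) : s → Fin n) Subtype.val_injective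
    simpa [Function.comp_def] using finrank_span_eq_card h
  · rw [← b.coe_toBasis] at hx
    have h := b.toBasis.repr_support_subset_of_mem_span _ hx
    by_contra hne
    exact hj (h (by simpa using hne))

namespace LinearMap

open Module InnerProductSpace

variable {𝕜 V W W' : Type*} [RCLike 𝕜]
  [NormedAddCommGroup V] [InnerProductSpace 𝕜 V] [FiniteDimensional 𝕜 V]
  [NormedAddCommGroup W] [InnerProductSpace 𝕜 W] [FiniteDimensional 𝕜 W]
  [NormedAddCommGroup W'] [InnerProductSpace 𝕜 W'] [FiniteDimensional 𝕜 W']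

theorem norm_sq_apply_eq_sum_singularValues (T : V →ₗ[𝕜] W) (x : V) :
    ‖T x‖ ^ 2 = ∑ j : Fin (finrank 𝕜 V), T.singularValues j ^ 2 *
      ‖(T.isSymmetric_adjoint_comp_self.eigenvectorBasis rfl).repr x j‖ ^ 2 := by
  set b := T.isSymmetric_adjoint_comp_self.eigenvectorBasis rfl with hb
  have h : ((‖T x‖ ^ 2 : ℝ) : 𝕜) = inner 𝕜 (b.repr x) (b.repr ((adjoint T ∘ₗ T) x)) := by
    rw [LinearIsometryEquiv.inner_map_map, comp_apply, adjoint_inner_right,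
      inner_self_eq_norm_sq_to_K]
    push_cast
    rfl
  apply RCLike.ofReal_injective (K := 𝕜)
  rw [h, PiLp.inner_apply, RCLike.ofReal_sum]
  refine Finset.sum_congr rfl fun j _ => ?_
  rw [hb, IsSymmetric.eigenvectorBasis_apply_self_apply, ← sq_singularValues_fin, ← hb,
    RCLike.inner_apply, mul_assoc, RCLike.mul_conj]
  push_cast
  rfl

/-- One half of Courant–Fischer: take the span of the right singular vectors with (zero-based)
indices `0, …, i`. -/
theorem exists_submodule_singularValues_mul_norm_le (T : V →ₗ[𝕜] W) {i : ℕ}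
    (hi : i < finrank 𝕜 V) :
    ∃ U : Submodule 𝕜 V, finrank 𝕜 U = i + 1 ∧ ∀ x ∈ U, T.singularValues i * ‖x‖ ≤ ‖T x‖ := by
  set b := T.isSymmetric_adjoint_comp_self.eigenvectorBasis rfl with hb
  obtain ⟨U, hU, hx⟩ := b.exists_submodule_repr_eq_zero (Finset.Iic ⟨i, hi⟩)
  refine ⟨U, by simpa using hU, fun x hxU => ?_⟩
  refine (sq_le_sq₀ (mul_nonneg (T.singularValues_nonneg i) (norm_nonneg _)) (norm_nonneg _)).1 ?_
  rw [mul_pow, norm_sq_apply_eq_sum_singularValues, ← b.repr.norm_map, EuclideanSpace.norm_sq_eq,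
    Finset.mul_sum]
  refine Finset.sum_le_sum fun j _ => ?_
  by_cases hj : j ∈ Finset.Iic (⟨i, hi⟩ : Fin (finrank 𝕜 V))
  · have := T.singularValues_antitone (Fin.le_def.1 (Finset.mem_Iic.1 hj))
    have := T.singularValues_nonneg i
    gcongr
  · rw [← hb, hx x hxU j hj]
    simp

/-- The other half: take the span of the right singular vectors from index `i` on. -/
theorem exists_submodule_norm_le_singularValues_mul (T : V →ₗ[𝕜] W) {i : ℕ}
    (hi : i < finrank 𝕜 V) :
    ∃ U : Submodule 𝕜 V, finrank 𝕜 U = finrank 𝕜 V - i ∧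
      ∀ x ∈ U, ‖T x‖ ≤ T.singularValues i * ‖x‖ := by
  set b := T.isSymmetric_adjoint_comp_self.eigenvectorBasis rfl with hb
  obtain ⟨U, hU, hx⟩ := b.exists_submodule_repr_eq_zero (Finset.Ici ⟨i, hi⟩)
  refine ⟨U, by simpa using hU, fun x hxU => ?_⟩
  refine (sq_le_sq₀ (norm_nonneg _) (mul_nonneg (T.singularValues_nonneg i) (norm_nonneg _))).1 ?_
  rw [mul_pow, norm_sq_apply_eq_sum_singularValues, ← b.repr.norm_map, EuclideanSpace.norm_sq_eq,
    Finset.mul_sum]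
  refine Finset.sum_le_sum fun j _ => ?_
  by_cases hj : j ∈ Finset.Ici (⟨i, hi⟩ : Fin (finrank 𝕜 V))
  · have := T.singularValues_antitone (Fin.le_def.1 (Finset.mem_Ici.1 hj))
    have := T.singularValues_nonneg j
    gcongr
  · rw [← hb, hx x hxU j hj]
    simp

/-- Weyl's inequality for singular values, up to a linear isometry of the domain. -/
theorem singularValues_le_add_of_norm_apply_le (T : V →ₗ[𝕜] W) (T' : V →ₗ[𝕜] W')
    (L : V →ₗᵢ[𝕜] V) {c : ℝ} (h : ∀ x, ‖T' (L x)‖ ≤ ‖T x‖ + c * ‖x‖) {i : ℕ}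
    (hi : i < finrank 𝕜 V) : T'.singularValues i ≤ T.singularValues i + c := by
  obtain ⟨U, hU, hxU⟩ := T'.exists_submodule_singularValues_mul_norm_le hi
  obtain ⟨Y, hY, hxY⟩ := T.exists_submodule_norm_le_singularValues_mul hi
  have hmap : finrank 𝕜 (Y.map L.toLinearMap) = finrank 𝕜 Y :=
    (Y.equivMapOfInjective L.toLinearMap L.injective).finrank_eq.symm
  -- The dimensions `i + 1` and `finrank 𝕜 V - i` add up to one more than `finrank 𝕜 V`, which
  -- forces a common nonzero vector.
  have hnd : ¬ Disjoint U (Y.map L.toLinearMap) := fun hd => by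
    have := Submodule.finrank_add_finrank_le_of_disjoint hd
    omega
  rw [Submodule.disjoint_def] at hnd
  push Not at hnd
  obtain ⟨y, hyU, ⟨x, hx, rfl⟩, hne⟩ := hnd
  have h1 := hxU _ hyU
  have h2 := hxY x hx
  have h3 := h x
  have hx0 : 0 < ‖x‖ := norm_pos_iff.2 fun h0 => hne (by simp [h0])
  simp only [LinearIsometry.coe_toLinearMap, L.norm_map] at h1
  refine le_of_mul_le_mul_right ?_ hx0
  linarith

end LinearMap

namespace Matrix

variable {m n : ℕ}

/-- The isometry of Euclidean space given by a unitary matrix. -/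
noncomputable def unitaryLinearIsometry (U : Matrix (Fin n) (Fin n) ℂ)
    (hU : U ∈ unitary (Matrix (Fin n) (Fin n) ℂ)) :
    EuclideanSpace ℂ (Fin n) →ₗᵢ[ℂ] EuclideanSpace ℂ (Fin n) :=
  U.toEuclideanLin.isometryOfInner fun x y => by
    rw [← LinearMap.adjoint_inner_right, ← toEuclideanLin_conjTranspose_eq_adjoint,
      ← LinearMap.comp_apply, ← toLpLin_mul_same, ← star_eq_conjTranspose,
      Unitary.star_mul_self_of_mem hU]
    simp

theorem norm_toEuclideanLin_of_mem_unitary {U : Matrix (Fin n) (Fin n) ℂ}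
    (hU : U ∈ unitary (Matrix (Fin n) (Fin n) ℂ)) (x : EuclideanSpace ℂ (Fin n)) :
    ‖U.toEuclideanLin x‖ = ‖x‖ :=
  (unitaryLinearIsometry U hU).norm_map x

theorem norm_toEuclideanLin_le (M : Matrix (Fin m) (Fin n) ℂ) (x : EuclideanSpace ℂ (Fin n)) :
    ‖M.toEuclideanLin x‖ ≤ ‖M‖ * ‖x‖ :=
  M.l2_opNorm_mulVec x

theorem l2_opNorm_le_one_of_mem_unitary {U : Matrix (Fin n) (Fin n) ℂ}
    (hU : U ∈ unitary (Matrix (Fin n) (Fin n) ℂ)) : ‖U‖ ≤ 1 := by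
  rw [l2_opNorm_def]
  refine ContinuousLinearMap.opNorm_le_bound _ zero_le_one fun x => ?_
  rw [one_mul]
  exact (norm_toEuclideanLin_of_mem_unitary hU x).le

theorem l2_opNorm_unitary_mul_mul_unitary_le {U : Matrix (Fin m) (Fin m) ℂ}
    {V : Matrix (Fin n) (Fin n) ℂ} (hU : U ∈ unitary (Matrix (Fin m) (Fin m) ℂ))
    (hV : V ∈ unitary (Matrix (Fin n) (Fin n) ℂ)) (M : Matrix (Fin m) (Fin n) ℂ) :
    ‖U * M * V‖ ≤ ‖M‖ := by
  have h1 := l2_opNorm_le_one_of_mem_unitary hU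
  have h2 := l2_opNorm_le_one_of_mem_unitary hV
  calc ‖U * M * V‖ ≤ ‖U‖ * ‖M‖ * ‖V‖ :=
        (l2_opNorm_mul _ _).trans (by gcongr; exact l2_opNorm_mul _ _)
    _ ≤ 1 * ‖M‖ * 1 := by gcongr
    _ = ‖M‖ := by ring

/-- Singular values of `A` and `B` differ by at most the distance of `B` to the unitary equivalence
class of `A`. -/
theorem abs_singularValues_sub_le_norm_unitary_mul_mul_unitary_sub
    (A B : Matrix (Fin m) (Fin n) ℂ) {U : Matrix (Fin m) (Fin m) ℂ} {V : Matrix (Fin n) (Fin n) ℂ}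
    (hU : U ∈ unitary (Matrix (Fin m) (Fin m) ℂ)) (hV : V ∈ unitary (Matrix (Fin n) (Fin n) ℂ))
    {i : ℕ} (hi : i < n) :
    |B.toEuclideanLin.singularValues i - A.toEuclideanLin.singularValues i| ≤
      ‖U * A * V - B‖ := by
  have hi' : i < Module.finrank ℂ (EuclideanSpace ℂ (Fin n)) := by simpa using hi
  have hUAV (x) : ‖(U * A * V).toEuclideanLin x‖ = ‖A.toEuclideanLin (V.toEuclideanLin x)‖ := by
    rw [toLpLin_mul 2 2 2, toLpLin_mul 2 2 2]
    exact norm_toEuclideanLin_of_mem_unitary hU _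
  have hsub (x) : ‖(U * A * V).toEuclideanLin x - B.toEuclideanLin x‖ ≤ ‖U * A * V - B‖ * ‖x‖ := by
    have := norm_toEuclideanLin_le (U * A * V - B) x
    rwa [map_sub, LinearMap.sub_apply] at this
  have hVV (x) : V.toEuclideanLin ((star V).toEuclideanLin x) = x := by
    rw [← LinearMap.comp_apply, ← toLpLin_mul_same, Unitary.mul_star_self_of_mem hV]
    simp
  -- `U` disappears under the norm and `V` is absorbed by the isometry of the domain: `star V` for
  -- one direction, `V` for the other.
  have h1 := LinearMap.singularValues_le_add_of_norm_apply_le A.toEuclideanLin B.toEuclideanLin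
    (unitaryLinearIsometry (star V) (Unitary.star_mem hV)) (c := ‖U * A * V - B‖) (fun x => ?_) hi'
  · have h2 := LinearMap.singularValues_le_add_of_norm_apply_le B.toEuclideanLin A.toEuclideanLin
      (unitaryLinearIsometry V hV) (c := ‖U * A * V - B‖) (fun x => ?_) hi'
    · rw [abs_le]
      constructor <;> linarith
    · change ‖A.toEuclideanLin (V.toEuclideanLin x)‖ ≤ _
      rw [← hUAV]
      have := norm_sub_norm_le ((U * A * V).toEuclideanLin x) (B.toEuclideanLin x)
      linarith [hsub x]
  · change ‖B.toEuclideanLin ((star V).toEuclideanLin x)‖ ≤ _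
    set y := (star V).toEuclideanLin x with hy
    have hyx : ‖y‖ = ‖x‖ := norm_toEuclideanLin_of_mem_unitary (Unitary.star_mem hV) x
    have h2 := hUAV y
    rw [hVV] at h2
    have := norm_sub_norm_le (B.toEuclideanLin y) ((U * A * V).toEuclideanLin y)
    rw [norm_sub_rev] at this
    rw [← h2, ← hyx]
    linarith [hsub y]

theorem isBoundedBilinearMap_mul (l m n : ℕ) : IsBoundedBilinearMap ℝ
    fun p : Matrix (Fin l) (Fin m) ℂ × Matrix (Fin m) (Fin n) ℂ => p.1 * p.2 where
  add_left := Matrix.add_mul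
  smul_left := Matrix.smul_mul
  add_right := Matrix.mul_add
  smul_right c x y := Matrix.mul_smul x c y
  bound := ⟨1, one_pos, fun x y => by simpa using l2_opNorm_mul x y⟩

theorem hasDerivAt_exp_smul_mul_mul_exp_smul (X : Matrix (Fin m) (Fin m) ℂ)
    (Y : Matrix (Fin n) (Fin n) ℂ) (B : Matrix (Fin m) (Fin n) ℂ) (t : ℝ) :
    HasDerivAt (fun s : ℝ => NormedSpace.exp (s • X) * B * NormedSpace.exp (s • Y))
      (NormedSpace.exp (t • X) * (X * B + B * Y) * NormedSpace.exp (t • Y)) t := by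
  -- The left exponential is differentiated as `exp * X`, the right one as `Y * exp`, so both
  -- generators land next to `B`.
  have hX := hasDerivAt_exp_smul_const (𝕂 := ℝ) X t
  have hY := hasDerivAt_exp_smul_const' (𝕂 := ℝ) Y t
  have h1 := ((isBoundedBilinearMap_mul m m n).hasFDerivAt
    (NormedSpace.exp (t • X), B)).comp_hasDerivAt t (hX.prodMk (hasDerivAt_const t B))
  have h2 := ((isBoundedBilinearMap_mul m n n).hasFDerivAt
    (NormedSpace.exp (t • X) * B, NormedSpace.exp (t • Y))).comp_hasDerivAt t (h1.prodMk hY)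
  refine h2.congr_deriv ?_
  simp only [IsBoundedBilinearMap.deriv_apply, Matrix.mul_zero, zero_add,
    Matrix.mul_add, Matrix.add_mul, Matrix.mul_assoc]
  exact add_comm _ _

theorem exp_smul_mem_unitary {S : Matrix (Fin n) (Fin n) ℂ} (hS : Sᴴ = -S) (t : ℝ) :
    NormedSpace.exp (t • S) ∈ unitary (Matrix (Fin n) (Fin n) ℂ) := by
  let +nondep : NormedAlgebra ℚ (Matrix (Fin n) (Fin n) ℂ) := .restrictScalars ℚ ℂ _
  refine NormedSpace.exp_mem_unitary_of_mem_skewAdjoint ?_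
  rw [skewAdjoint.mem_iff, star_smul, star_eq_conjTranspose, hS]
  simp

/-- Second order Taylor bound for the orbit `t ↦ exp (t X) * A * exp (t Y)`. -/
theorem norm_exp_mul_mul_exp_sub_le {X : Matrix (Fin m) (Fin m) ℂ}
    {Y : Matrix (Fin n) (Fin n) ℂ} (hX : Xᴴ = -X) (hY : Yᴴ = -Y) (A : Matrix (Fin m) (Fin n) ℂ) :
    ‖NormedSpace.exp X * A * NormedSpace.exp Y - (A + (X * A + A * Y))‖ ≤
      1 / 2 * ‖X * (X * A + A * Y) + (X * A + A * Y) * Y‖ := by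
  set D := X * A + A * Y with hD
  set G := X * D + D * Y with hG
  -- Mean value inequality for the velocity: its derivative is `G` between two unitaries, of norm at
  -- most `‖G‖`.
  have h1 : ∀ t ∈ Set.Icc (0 : ℝ) 1,
      ‖NormedSpace.exp (t • X) * D * NormedSpace.exp (t • Y) - D‖ ≤ ‖G‖ * t := fun t ht => by
    simpa using norm_image_sub_le_of_norm_deriv_le_segment'
      (fun s _ => (hasDerivAt_exp_smul_mul_mul_exp_smul X Y D s).hasDerivWithinAt)
      (fun s _ => l2_opNorm_unitary_mul_mul_unitary_le (exp_smul_mem_unitary hX s)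
        (exp_smul_mem_unitary hY s) G) t ht
  have h2 (t : ℝ) : HasDerivAt
      (fun s : ℝ => NormedSpace.exp (s • X) * A * NormedSpace.exp (s • Y) - (A + s • D))
      (NormedSpace.exp (t • X) * D * NormedSpace.exp (t • Y) - D) t := by
    have h3 := ((hasDerivAt_id t).smul_const D).const_add A
    rw [one_smul] at h3
    exact (hasDerivAt_exp_smul_mul_mul_exp_smul X Y A t).sub h3
  -- Integrating the bound `‖G‖ * t` on the derivative of the remainder produces the factor `1 / 2`.
  have h3 (t : ℝ) : HasDerivAt (fun s : ℝ => 1 / 2 * ‖G‖ * s ^ 2) (‖G‖ * t) t :=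
    ((hasDerivAt_pow 2 t).const_mul (1 / 2 * ‖G‖)).congr_deriv (by ring)
  have h4 := image_norm_le_of_norm_deriv_right_le_deriv_boundary
    (fun t _ => (h2 t).continuousAt.continuousWithinAt) (fun t _ => (h2 t).hasDerivWithinAt)
    (by simp) h3 (fun t ht => h1 t (Set.Ico_subset_Icc_self ht)) (Set.right_mem_Icc.2 zero_le_one)
  simpa using h4

end Matrix

theorem mainTheorem9 (m n : ℕ) (A E : Matrix (Fin m) (Fin n) ℂ)
    (S₁ : Matrix (Fin m) (Fin m) ℂ) (S₂ : Matrix (Fin n) (Fin n) ℂ)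
    (hS₁ : S₁ᴴ = -S₁) (hS₂ : S₂ᴴ = -S₂) (hE : E = S₁ * A + A * S₂) :
    (∀ i : Fin (min m n),
      |(Matrix.toEuclideanLin (A + E)).singularValues i -
          (Matrix.toEuclideanLin A).singularValues i| ≤
        (1 / 2 : ℝ) * ‖S₁ ^ 2 * A + (2 : ℂ) • (S₁ * A * S₂) + A * S₂ ^ 2‖) ∧
    (1 / 2 : ℝ) * ‖S₁ ^ 2 * A + (2 : ℂ) • (S₁ * A * S₂) + A * S₂ ^ 2‖ ≤
      (1 / 2 : ℝ) * ‖E‖ * (‖S₁‖ + ‖S₂‖) := by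
  have hG : S₁ ^ 2 * A + (2 : ℂ) • (S₁ * A * S₂) + A * S₂ ^ 2 = S₁ * E + E * S₂ := by
    rw [hE, two_smul, pow_two, pow_two]
    simp only [Matrix.mul_add, Matrix.add_mul, Matrix.mul_assoc]
    abel
  rw [hG]
  refine ⟨fun i => ?_, ?_⟩
  · have hexp {k : ℕ} {S : Matrix (Fin k) (Fin k) ℂ} (hS : Sᴴ = -S) :
        NormedSpace.exp S ∈ unitary (Matrix (Fin k) (Fin k) ℂ) := by
      simpa using Matrix.exp_smul_mem_unitary hS 1
    refine (Matrix.abs_singularValues_sub_le_norm_unitary_mul_mul_unitary_sub A (A + E)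
      (hexp hS₁) (hexp hS₂) (i.isLt.trans_le (min_le_right m n))).trans ?_
    rw [hE]
    exact Matrix.norm_exp_mul_mul_exp_sub_le hS₁ hS₂ A
  · have h1 := Matrix.l2_opNorm_mul S₁ E
    have h2 := Matrix.l2_opNorm_mul E S₂
    have h3 := norm_add_le (S₁ * E) (E * S₂)
    linarith
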